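/- Let $\tau>0$ and let $(\lambda_k)_{k\in\mathbb N}$, $(\gamma_k)_{k\in\mathbb N}$ be sequences of complex numbers, $\lambda_k=a_k+i\beta_k$ with $a_k,\beta_k\in\mathbb R$. For $\lambda,\gamma\in\mathbb C$ the scalar delay equation $z'(t)=\lambda z(t)+\gamma z(t-\tau)$ is called stable if every root $s\in\mathbb C$ of its characteristic equation $s-\lambda-\gamma e^{-s\tau}=0$ satisfies $\operatorname{Re}s<0$. Let $\operatorname{Arg}$ be the principal argument with values in $(-\pi,\pi]$, let $\mathbb D_r=\{\eta\in\mathbb C:|\eta|<r\}$, and for $a<\frac1\tau$ define $\Lambda_{\tau,a}\subset\mathbb C$ as follows. * If $a<0$, then $$\Lambda_{\tau,a}=\Big\{\eta\in\mathbb C\setminus\mathbb D_{|a|}:\ \operatorname{Re}\eta+a<0,\ |\eta|<|\eta_\pi|,\ |\operatorname{Arg}\eta|>\tau\sqrt{|\eta|^2-a^2}+\arctan\Big(-\tfrac1a\sqrt{|\eta|^2-a^2}\Big)\Big\}\cup\mathbb D_{|a|},$$ where $|\eta_\pi|\ge|a|$ is the unique modulus with $\tau\sqrt{|\eta_\pi|^2-a^2}+\arctan\big(-\tfrac1a\sqrt{|\eta_\pi|^2-a^2}\big)=\pi$.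 * If $a=0$, then $$\Lambda_{\tau,a}=\Big\{\eta\in\mathbb C\setminus\{0\}:\ \operatorname{Re}\eta<0,\ |\eta|<\tfrac{\pi}{2\tau},\ |\operatorname{Arg}\eta|>\tau|\eta|+\tfrac\pi2\Big\}.$$ * If $0<a<\frac1\tau$, then $$\Lambda_{\tau,a}=\Big\{\eta\in\mathbb C:\ \operatorname{Re}\eta+a<0,\ |\eta|<|\eta_\pi|,\ |\operatorname{Arg}\eta|>\tau\sqrt{|\eta|^2-a^2}+\arctan\Big(-\tfrac1a\sqrt{|\eta|^2-a^2}\Big)+\pi\Big\},$$ where $|\eta_\pi|>a$ is the unique modulus with $\tau\sqrt{|\eta_\pi|^2-a^2}+\arctan\big(-\tfrac1a\sqrt{|\eta_\pi|^2-a^2}\big)=0$. Then the equations $z_k'(t)=\lambda_kz_k(t)+\gamma_kz_k(t-\tau)$ are stable for all $k\in\mathbb N$ if and only if, for all $k\in\mathbb N$, $$\operatorname{Re}\lambda_k<\frac1\tau\qquad\text{and}\qquad \gamma_ke^{-i\beta_k\tau}\in\Lambda_{\tau,a_k}.$$ -/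

import Mathlib

namespace DelayStability

/-- The characteristic function `s - lam - gam * e^{-s τ}` of the scalar delay equation
`z'(t) = lam * z(t) + gam * z(t - τ)`. -/
noncomputable def charFun (τ : ℝ) (lam gam s : ℂ) : ℂ :=
  s - lam - gam * Complex.exp (-(s * (τ : ℂ)))

/-- The scalar delay equation `z'(t) = lam * z(t) + gam * z(t - τ)` is called stable when all the
roots of its characteristic equation `s - lam - gam * e^{-s τ} = 0` have negative real parts. -/
def IsStable (τ : ℝ) (lam gam : ℂ) : Prop :=
  ∀ s : ℂ, charFun τ lam gam s = 0 → s.re < 0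

/-- `Λ_{τ,a}` for `a < 0`. The modulus of `ηπ` is determined uniquely by the equation it has to
satisfy; `Complex.arg` is the principal argument, with values in `(-π, π]`. -/
noncomputable def LambdaNeg (τ a : ℝ) : Set ℂ :=
  {η : ℂ | η ∉ Metric.ball (0 : ℂ) |a| ∧ η.re + a < 0 ∧
      (∃ ηπ : ℂ,
        √(‖ηπ‖ ^ 2 - a ^ 2) * τ + Real.arctan (-(1 / a) * √(‖ηπ‖ ^ 2 - a ^ 2)) = Real.pi ∧
        ‖η‖ < ‖ηπ‖) ∧
      τ * √(‖η‖ ^ 2 - a ^ 2) + Real.arctan (-(1 / a) * √(‖η‖ ^ 2 - a ^ 2)) < |Complex.arg η|}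
    ∪ Metric.ball (0 : ℂ) |a|

/-- `Λ_{τ,a}` for `a = 0`. -/
noncomputable def LambdaZero (τ : ℝ) : Set ℂ :=
  {η : ℂ | η ≠ 0 ∧ η.re < 0 ∧ ‖η‖ < Real.pi / (2 * τ) ∧
      τ * ‖η‖ + Real.pi / 2 < |Complex.arg η|}

/-- `Λ_{τ,a}` for `0 < a ≤ 1 / τ`. For `a < 1 / τ` the modulus of `ηπ` is determined uniquely by
its two conditions. -/
noncomputable def LambdaPos (τ a : ℝ) : Set ℂ :=
  {η : ℂ | η.re + a < 0 ∧
      (∃ ηπ : ℂ, a < ‖ηπ‖ ∧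
        √(‖ηπ‖ ^ 2 - a ^ 2) * τ + Real.arctan (-(1 / a) * √(‖ηπ‖ ^ 2 - a ^ 2)) = 0 ∧
        ‖η‖ < ‖ηπ‖) ∧
      τ * √(‖η‖ ^ 2 - a ^ 2) + Real.arctan (-(1 / a) * √(‖η‖ ^ 2 - a ^ 2)) + Real.pi
        < |Complex.arg η|}

/-- The set `Λ_{τ,a}`, meant for `τ > 0` and `a ≤ 1 / τ`. -/
noncomputable def Lambda (τ a : ℝ) : Set ℂ :=
  if a < 0 then LambdaNeg τ a else if a = 0 then LambdaZero τ else LambdaPos τ a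

end DelayStability

namespace DelayStability

open Real Set

/-! Translating roots by `i β` reduces to real `λ = a`, where roots solve `(z - a) e^{zτ} = η`.
Comparing moduli puts `z` on a level curve having at most one point in the closed upper half plane
for each real part `x`; there the argument of the left side is `levelArg`. Roots with nonnegative
real part thus become solutions of `levelArg = Arg η` with `x ≥ 0`, up to conjugation. When `aτ < 1`
and `|a| ≤ |η|`, `levelArg` decreases from its value at `x = 0` to `0`, so stability means `|Arg η|`
exceeds that critical value (`isStable_iff_lt_abs_arg`). Monotonicity gives sufficiency
(`abs_arg_le_of_root`), the intermediate value theorem necessity (`not_isStable_of_arg`). The other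
clauses of `Λ`, on `Re η` and `|η_π|`, follow from the argument inequality. -/

/-- The cosine of the argument of `z - a`, for `z` with real part `x` on the level curve
`|(z - a) e^{z τ}| = r`. -/
noncomputable def levelCos (τ a r x : ℝ) : ℝ := (x - a) * exp (x * τ) / r

/-- The argument of `(z - a) e^{z τ}`, for `z` in the upper half plane with real part `x` on the
level curve `|(z - a) e^{z τ}| = r`. -/
noncomputable def levelArg (τ a r x : ℝ) : ℝ :=
  arccos (levelCos τ a r x) + τ * (r * exp (-(x * τ))) * √(1 - levelCos τ a r x ^ 2)

/-! ### Calculus along the level curve -/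

theorem continuous_levelCos (τ a r : ℝ) : Continuous (levelCos τ a r) := by
  unfold levelCos; fun_prop

theorem continuous_levelArg (τ a r : ℝ) : Continuous (levelArg τ a r) := by
  have := continuous_levelCos τ a r
  unfold levelArg; fun_prop

theorem levelArg_of_levelCos_eq_one {τ a r x : ℝ} (h : levelCos τ a r x = 1) :
    levelArg τ a r x = 0 := by
  simp [levelArg, h]

theorem levelArg_of_levelCos_eq_neg_one {τ a r x : ℝ} (h : levelCos τ a r x = -1) :
    levelArg τ a r x = π := by
  simp [levelArg, h]

theorem hasDerivAt_levelCos (τ a r x : ℝ) :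
    HasDerivAt (levelCos τ a r) ((1 + τ * (x - a)) * exp (x * τ) / r) x := by
  have h1 : HasDerivAt (fun x : ℝ => exp (x * τ)) (exp (x * τ) * (1 * τ)) x :=
    ((hasDerivAt_id x).mul_const τ).exp
  have h2 := (((hasDerivAt_id x).sub_const a).mul h1).div_const r
  refine (h2.congr_deriv ?_)
  simp only [id]
  ring

theorem strictMonoOn_levelCos {τ a r : ℝ} (hτ : 0 < τ) (hr : 0 < r) (ha : a * τ < 1) :
    StrictMonoOn (levelCos τ a r) (Ici 0) := by
  apply strictMonoOn_of_deriv_pos (convex_Ici 0) (continuous_levelCos τ a r).continuousOn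
  intro x hx
  rw [interior_Ici, mem_Ioi] at hx
  rw [(hasDerivAt_levelCos τ a r x).deriv]
  have : 0 < 1 + τ * (x - a) := by nlinarith [mul_pos hτ hx]
  positivity

theorem hasDerivAt_levelArg {τ a r x : ℝ} (hr : 0 < r) (h1 : -1 < levelCos τ a r x)
    (h2 : levelCos τ a r x < 1) :
    HasDerivAt (levelArg τ a r)
      (-((1 + τ * (x - a)) ^ 2 * exp (x * τ) / (r * √(1 - levelCos τ a r x ^ 2))
        + τ ^ 2 * (r * exp (-(x * τ))) * √(1 - levelCos τ a r x ^ 2))) x := by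
  have hc := hasDerivAt_levelCos τ a r x
  have hpos : 0 < 1 - levelCos τ a r x ^ 2 := by nlinarith
  have hs : 0 < √(1 - levelCos τ a r x ^ 2) := sqrt_pos.2 hpos
  have h3 := (hasDerivAt_arccos h1.ne' h2.ne).comp x hc
  have h4 : HasDerivAt (fun x : ℝ => exp (-(x * τ))) (exp (-(x * τ)) * (-(1 * τ))) x :=
    (((hasDerivAt_id x).mul_const τ).neg).exp
  have h5 := ((hc.pow 2).const_sub 1).sqrt hpos.ne'
  have h6 := h3.add (((h4.const_mul r).const_mul τ).mul h5)
  refine h6.congr_deriv ?_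
  have hcx : r * exp (-(x * τ)) * levelCos τ a r x = x - a := by
    unfold levelCos
    rw [exp_neg]; field_simp
  have hpow : √(1 - (levelCos τ a r ^ 2) x) = √(1 - levelCos τ a r x ^ 2) := rfl
  rw [hpow]
  set s := √(1 - levelCos τ a r x ^ 2)
  set c := levelCos τ a r x
  generalize exp (x * τ) = E at *
  generalize exp (-(x * τ)) = e at *
  push_cast
  field_simp
  linear_combination (-τ * (1 + τ * (x - a)) * E) * hcx

theorem antitoneOn_levelArg {τ a r X : ℝ} (hr : 0 < r)
    (h : ∀ x ∈ Ioo 0 X, -1 < levelCos τ a r x ∧ levelCos τ a r x < 1) :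
    AntitoneOn (levelArg τ a r) (Icc 0 X) := by
  have hd := fun x (hx : x ∈ Ioo 0 X) => hasDerivAt_levelArg hr (h x hx).1 (h x hx).2
  apply antitoneOn_of_deriv_nonpos (convex_Icc 0 X) (continuous_levelArg τ a r).continuousOn
  · rw [interior_Icc]
    exact fun x hx => (hd x hx).differentiableAt.differentiableWithinAt
  · rw [interior_Icc]
    intro x hx
    rw [(hd x hx).deriv, neg_nonpos]
    positivity

theorem levelCos_zero (τ a r : ℝ) : levelCos τ a r 0 = -a / r := by
  simp [levelCos]

/-- No bound `|a| ≤ r` is needed: otherwise both square roots have negative radicands and vanish. -/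
theorem levelArg_zero {τ a r : ℝ} (hr : 0 < r) :
    levelArg τ a r 0 = arccos (-a / r) + τ * √(r ^ 2 - a ^ 2) := by
  have h : r ^ 2 - a ^ 2 = r ^ 2 * (1 - (-a / r) ^ 2) := by field_simp
  rw [h, sqrt_mul (sq_nonneg r), sqrt_sq hr.le, levelArg, levelCos_zero]
  simp
  ring

/-! ### Roots and the level curve -/

theorem charFun_ofReal_eq_zero_iff {τ a : ℝ} {η z : ℂ} :
    charFun τ a η z = 0 ↔ (z - a) * Complex.exp (z * τ) = η := by
  have hE : Complex.exp (z * τ) ≠ 0 := Complex.exp_ne_zero _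
  rw [charFun, Complex.exp_neg, sub_eq_zero, ← div_eq_mul_inv, eq_div_iff hE]

theorem charFun_conj {τ a : ℝ} {η z : ℂ} (h : charFun τ a η z = 0) :
    charFun τ a (starRingEnd ℂ η) (starRingEnd ℂ z) = 0 := by
  rw [charFun_ofReal_eq_zero_iff] at h ⊢
  rw [← h, map_mul, ← Complex.exp_conj]
  simp

theorem abs_arg_conj (η : ℂ) : |Complex.arg (starRingEnd ℂ η)| = |Complex.arg η| := by
  rw [Complex.arg_conj]
  split_ifs with h
  · rw [h]
  · rw [abs_neg]

theorem norm_sub_mul_exp {τ a : ℝ} {η z : ℂ} (h : charFun τ a η z = 0) :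
    ‖z - a‖ * exp (z.re * τ) = ‖η‖ := by
  rw [charFun_ofReal_eq_zero_iff] at h
  rw [← h, norm_mul, Complex.norm_exp]
  simp

theorem isStable_conj {τ a : ℝ} {η : ℂ} (h : IsStable τ a η) :
    IsStable τ a (starRingEnd ℂ η) := by
  intro s hs
  have hs' := charFun_conj hs
  rw [Complex.conj_conj] at hs'
  simpa using h _ hs'

/-- On the level curve, `levelArg` gives solutions of the characteristic equation. -/
theorem exists_charFun_eq_zero {τ a x : ℝ} {η : ℂ} (hη : η ≠ 0)
    (h1 : -1 ≤ levelCos τ a ‖η‖ x) (h2 : levelCos τ a ‖η‖ x ≤ 1)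
    (h : levelArg τ a ‖η‖ x = Complex.arg η) :
    ∃ z : ℂ, z.re = x ∧ charFun τ a η z = 0 := by
  have hr : 0 < ‖η‖ := norm_pos_iff.2 hη
  set r := ‖η‖ with hrdef
  set φ := arccos (levelCos τ a r x) with hφ
  set y := r * exp (-(x * τ)) * √(1 - levelCos τ a r x ^ 2) with hy
  have hcos : x - a = r * exp (-(x * τ)) * cos φ := by
    rw [hφ, cos_arccos h1 h2, levelCos, exp_neg]
    field_simp
  have hsin : y = r * exp (-(x * τ)) * sin φ := by rw [hφ, sin_arccos]
  have hza : ((x : ℂ) + y * Complex.I - a)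
      = (r * exp (-(x * τ)) : ℝ) * Complex.exp (φ * Complex.I) := by
    rw [Complex.exp_mul_I, ← Complex.ofReal_cos, ← Complex.ofReal_sin]
    have : ((x : ℂ) + y * Complex.I - a) = ((x - a : ℝ) : ℂ) + (y : ℝ) * Complex.I := by
      push_cast; ring
    rw [this, hcos, hsin]
    push_cast
    ring
  refine ⟨x + y * Complex.I, by simp, ?_⟩
  rw [charFun_ofReal_eq_zero_iff, hza]
  conv_rhs => rw [← Complex.norm_mul_exp_arg_mul_I η, ← h, ← hrdef]
  rw [Complex.ofReal_mul, Complex.ofReal_exp, mul_assoc, mul_assoc, ← Complex.exp_add,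
    ← Complex.exp_add]
  congr 2
  rw [levelArg, ← hφ]
  push_cast
  rw [hy]
  push_cast
  ring

/-- A root in the closed upper half plane lies on the level curve. -/
theorem arg_eq_levelArg {τ a : ℝ} {η z : ℂ} (hη : η ≠ 0) (hz : charFun τ a η z = 0)
    (him : 0 ≤ z.im) (h0 : 0 ≤ levelArg τ a ‖η‖ z.re) (hπ : levelArg τ a ‖η‖ z.re ≤ π) :
    Complex.arg η = levelArg τ a ‖η‖ z.re := by
  have hr : 0 < ‖η‖ := norm_pos_iff.2 hη
  have hn := norm_sub_mul_exp hz
  have hne : z - a ≠ 0 := by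
    intro h; rw [h] at hn; simp at hn; exact hr.ne hn
  have hnorm : ‖z - a‖ = ‖η‖ * exp (-(z.re * τ)) := by
    rw [← hn, exp_neg]; field_simp
  have harg : Complex.arg (z - a) = arccos (levelCos τ a ‖η‖ z.re) := by
    rw [Complex.arg_of_im_nonneg_of_ne_zero (by simpa using him) hne, hnorm, levelCos, exp_neg]
    congr 1
    simp
    field_simp
  have him' : z.im = ‖η‖ * exp (-(z.re * τ)) * √(1 - levelCos τ a ‖η‖ z.re ^ 2) := by
    rw [← sin_arccos, ← harg, ← hnorm, Complex.norm_mul_sin_arg]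
    simp
  have key : η = ‖η‖ * Complex.exp (levelArg τ a ‖η‖ z.re * Complex.I) := by
    conv_lhs => rw [← charFun_ofReal_eq_zero_iff.1 hz, ← Complex.norm_mul_exp_arg_mul_I (z - a),
      hnorm, harg]
    rw [Complex.ofReal_mul, Complex.ofReal_exp, mul_assoc, mul_assoc, ← Complex.exp_add,
      ← Complex.exp_add]
    congr 2
    rw [levelArg, mul_assoc τ, ← him']
    push_cast
    linear_combination (-(τ : ℂ)) * Complex.re_add_im z
  conv_lhs => rw [key]
  rw [Complex.exp_mul_I, Complex.arg_mul_cos_add_sin_mul_I hr ⟨by linarith [pi_pos], hπ⟩]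

theorem levelArg_nonneg {τ a r x : ℝ} (hτ : 0 < τ) (hr : 0 < r) : 0 ≤ levelArg τ a r x :=
  add_nonneg (arccos_nonneg _) (by positivity)

theorem levelCos_re_le_one {τ a : ℝ} {η z : ℂ} (hη : η ≠ 0) (hz : charFun τ a η z = 0) :
    levelCos τ a ‖η‖ z.re ≤ 1 := by
  have hr : 0 < ‖η‖ := norm_pos_iff.2 hη
  rw [levelCos, div_le_one hr, ← norm_sub_mul_exp hz]
  have := (le_abs_self _).trans (Complex.abs_re_le_norm (z - a))
  simp only [Complex.sub_re, Complex.ofReal_re] at this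
  gcongr

/-! ### Stability and the critical argument -/

/-- If there is a root in the closed right half plane, the argument of `η` is at most the critical
one. -/
theorem abs_arg_le_of_root {τ a : ℝ} {η z : ℂ} (hτ : 0 < τ) (ha : a * τ < 1) (hη : η ≠ 0)
    (har : a ≤ ‖η‖) (hz : charFun τ a η z = 0) (hre : 0 ≤ z.re) :
    |Complex.arg η| ≤ levelArg τ a ‖η‖ 0 := by
  wlog him : 0 ≤ z.im generalizing η z
  · have := this (η := starRingEnd ℂ η) (z := starRingEnd ℂ z) (by simpa using hη)
      (by simpa using har) (charFun_conj hz) (by simpa using hre) (by simp; linarith)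
    simpa [abs_arg_conj] using this
  have hr : 0 < ‖η‖ := norm_pos_iff.2 hη
  -- Below `π`, `levelArg` is a principal argument, with no wrapping modulo `2π`.
  rcases le_or_gt π (levelArg τ a ‖η‖ 0) with hπ | hπ
  · exact (Complex.abs_arg_le_pi η).trans hπ
  have hmono := strictMonoOn_levelCos (a := a) hτ hr ha
  have hanti : AntitoneOn (levelArg τ a ‖η‖) (Icc 0 z.re) := by
    apply antitoneOn_levelArg hr
    intro x hx
    constructor
    · have h1 := hmono self_mem_Ici (mem_Ici.2 hx.1.le) hx.1
      rw [levelCos_zero] at h1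
      refine lt_of_le_of_lt ?_ h1
      rw [le_div_iff₀ hr]; linarith
    · exact (hmono (mem_Ici.2 hx.1.le) (mem_Ici.2 hre) hx.2).trans_le (levelCos_re_le_one hη hz)
  have hle := hanti ⟨le_rfl, hre⟩ ⟨hre, le_rfl⟩ hre
  have h0 := levelArg_nonneg (a := a) (x := z.re) hτ hr
  rw [arg_eq_levelArg hη hz him h0 (hle.trans hπ.le), abs_of_nonneg h0]
  exact hle

/-- Used to cut out an interval on which `levelCos` stays in `[-1, 1]`, so that the level curve has
a point above every `x`. -/
theorem exists_first_eq {f : ℝ → ℝ} (hf : Continuous f) {a b v : ℝ} (hab : a ≤ b)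
    (ha : f a ≤ v) (hb : v ≤ f b) : ∃ x ∈ Icc a b, f x = v ∧ ∀ y ∈ Icc a x, f y ≤ v := by
  have hc : IsCompact (Icc a b ∩ f ⁻¹' {v}) :=
    isCompact_Icc.inter_right (isClosed_singleton.preimage hf)
  obtain ⟨t, ht, htv⟩ := intermediate_value_Icc hab hf.continuousOn ⟨ha, hb⟩
  obtain ⟨x, ⟨hx, hxv⟩, hmin⟩ := hc.exists_isLeast ⟨t, ht, htv⟩
  refine ⟨x, hx, hxv, fun y hy => ?_⟩
  by_contra! hlt
  obtain ⟨w, hw, hwv⟩ := intermediate_value_Icc hy.1 hf.continuousOn ⟨ha, hlt.le⟩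
  have h1 := hmin ⟨⟨hw.1, hw.2.trans (hy.2.trans hx.2)⟩, hwv⟩
  have h2 : y = x := le_antisymm hy.2 (h1.trans hw.2)
  rw [h2] at hlt
  exact hlt.ne' hxv

theorem exists_last_eq {f : ℝ → ℝ} (hf : Continuous f) {a b v : ℝ} (hab : a ≤ b)
    (ha : f a ≤ v) (hb : v ≤ f b) : ∃ x ∈ Icc a b, f x = v ∧ ∀ y ∈ Icc x b, v ≤ f y := by
  obtain ⟨x, hx, hxv, h⟩ := exists_first_eq (f := fun t => -f (-t)) (a := -b) (b := -a) (v := -v)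
    (by fun_prop) (by linarith) (by simpa using hb) (by simpa using ha)
  refine ⟨-x, ⟨by linarith [hx.2], by linarith [hx.1]⟩, by simpa using hxv, fun y hy => ?_⟩
  simpa using h (-y) ⟨by linarith [hy.2], by linarith [hy.1]⟩

theorem exists_one_le_levelCos {τ a r : ℝ} (hτ : 0 < τ) (hr : 0 < r) :
    ∃ x, 0 ≤ x ∧ 1 ≤ levelCos τ a r x := by
  refine ⟨|a| + r, by positivity, ?_⟩
  rw [levelCos, le_div_iff₀ hr, one_mul]
  have h1 : 1 ≤ exp ((|a| + r) * τ) := one_le_exp (by positivity)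
  nlinarith [le_abs_self a]

/-- There is a root in the closed right half plane if the argument of `η` is at most the critical
one, or if the level curve reaches the negative real direction in the right half plane. -/
theorem not_isStable_of_arg {τ a : ℝ} {η : ℂ} (hτ : 0 < τ) (hη : η ≠ 0) (h1 : -a ≤ ‖η‖)
    (h : ‖η‖ ≤ a ∨ |Complex.arg η| ≤ levelArg τ a ‖η‖ 0) : ¬ IsStable τ a η := by
  wlog hnn : 0 ≤ Complex.arg η generalizing η
  · intro hs
    refine this (η := starRingEnd ℂ η) (by simpa using hη) (by simpa using h1)
      (by simpa [abs_arg_conj] using h) ?_ (isStable_conj hs)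
    rw [Complex.arg_conj]
    split_ifs
    · exact pi_pos.le
    · linarith
  intro hs
  have hr : 0 < ‖η‖ := norm_pos_iff.2 hη
  have hcont := continuous_levelCos τ a ‖η‖
  obtain ⟨M, hM, hM1⟩ := exists_one_le_levelCos (a := a) hτ hr
  have hc0 : levelCos τ a ‖η‖ 0 ≤ 1 := by
    rw [levelCos_zero, div_le_one hr]; exact h1
  obtain ⟨X, hX, hX1, hXle⟩ := exists_first_eq hcont hM hc0 hM1
  -- The left end is the last point with `levelCos = -1`, where `levelArg = π`, or `0` if there is
  -- none.
  obtain ⟨x₁, hx₁, hge, harg⟩ : ∃ x₁ ∈ Icc 0 X, (∀ y ∈ Icc x₁ X, -1 ≤ levelCos τ a ‖η‖ y) ∧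
      Complex.arg η ≤ levelArg τ a ‖η‖ x₁ := by
    by_cases hex : ∃ x ∈ Icc 0 X, levelCos τ a ‖η‖ x ≤ -1
    · obtain ⟨x, hx, hxc⟩ := hex
      obtain ⟨x₁, hx₁, hx₁c, hl⟩ := exists_last_eq hcont hx.2 hxc (by rw [hX1]; norm_num)
      refine ⟨x₁, ⟨hx.1.trans hx₁.1, hx₁.2⟩, hl, ?_⟩
      rw [levelArg_of_levelCos_eq_neg_one hx₁c]
      exact Complex.arg_le_pi η
    · push Not at hex
      refine ⟨0, ⟨le_rfl, hX.1⟩, fun y hy => (hex y hy).le, ?_⟩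
      rcases h with h | h
      · have := hex 0 ⟨le_rfl, hX.1⟩
        rw [levelCos_zero, lt_div_iff₀ hr] at this
        linarith
      · exact (le_abs_self _).trans h
  obtain ⟨x, hx, hxη⟩ := intermediate_value_Icc' hx₁.2
    (continuous_levelArg τ a ‖η‖).continuousOn
    ⟨by rw [levelArg_of_levelCos_eq_one hX1]; exact hnn, harg⟩
  obtain ⟨z, hz, hz0⟩ := exists_charFun_eq_zero hη (hge x hx)
    (hXle x ⟨hx₁.1.trans hx.1, hx.2⟩) hxη
  have := hs z hz0
  linarith [hx₁.1, hx.1]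

theorem not_isStable_zero {τ a : ℝ} (ha : 0 ≤ a) : ¬ IsStable τ a 0 := by
  intro h
  have := h a (by simp [charFun])
  simp at this
  linarith

/-- In the closed right half plane `|z - a| ≥ |a|` and `|e^{zτ}| ≥ 1`. -/
theorem isStable_of_norm_lt {τ a : ℝ} {η : ℂ} (hτ : 0 < τ) (ha : a < 0) (h : ‖η‖ < |a|) :
    IsStable τ a η := by
  intro z hz
  by_contra! hre
  have h1 := norm_sub_mul_exp hz
  have h2 : 1 ≤ exp (z.re * τ) := one_le_exp (by positivity)
  have h3 := (le_abs_self _).trans (Complex.abs_re_le_norm (z - a))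
  simp only [Complex.sub_re, Complex.ofReal_re] at h3
  rw [abs_of_neg ha] at h
  nlinarith [norm_nonneg (z - a)]

/-! ### The critical angle as an arctangent, and the sets `Λ` -/

theorem arccos_div_eq_arctan {b r : ℝ} (hb : 0 < b) (hr : 0 < r) :
    arccos (b / r) = arctan (√(r ^ 2 - b ^ 2) / b) := by
  have h : r ^ 2 - b ^ 2 = r ^ 2 * (1 - (b / r) ^ 2) := by field_simp
  rw [arccos_eq_arctan (by positivity), h, sqrt_mul (sq_nonneg _), sqrt_sq hr.le]
  congr 1
  field_simp

theorem levelArg_zero_of_neg {τ a r : ℝ} (ha : a < 0) (hr : 0 < r) :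
    levelArg τ a r 0 = τ * √(r ^ 2 - a ^ 2) + arctan (-(1 / a) * √(r ^ 2 - a ^ 2)) := by
  rw [levelArg_zero hr, arccos_div_eq_arctan (neg_pos.2 ha) hr, neg_sq, add_comm, div_neg,
    neg_mul, one_div_mul_eq_div]

theorem levelArg_zero_of_pos {τ a r : ℝ} (ha : 0 < a) (hr : 0 < r) :
    levelArg τ a r 0 = τ * √(r ^ 2 - a ^ 2) + arctan (-(1 / a) * √(r ^ 2 - a ^ 2)) + π := by
  rw [levelArg_zero hr, neg_div, arccos_neg, arccos_div_eq_arctan ha hr, neg_mul, arctan_neg,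
    one_div_mul_eq_div]
  ring

/-- Since `arctan u ≤ u` and `1/a ≤ τ`, the critical angle is at least `π`. -/
theorem not_isStable_of_one_le {τ a : ℝ} {η : ℂ} (hτ : 0 < τ) (ha : 1 ≤ a * τ) :
    ¬ IsStable τ a η := by
  have ha0 : 0 < a := by
    by_contra! h; nlinarith
  rcases eq_or_ne η 0 with rfl | hη
  · exact not_isStable_zero ha0.le
  have hr : 0 < ‖η‖ := norm_pos_iff.2 hη
  apply not_isStable_of_arg hτ hη (by linarith)
  right
  rw [levelArg_zero_of_pos ha0 hr, neg_mul, arctan_neg, one_div_mul_eq_div]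
  have h1 : arctan (√(‖η‖ ^ 2 - a ^ 2) / a) ≤ √(‖η‖ ^ 2 - a ^ 2) / a := by
    conv_rhs => rw [← tan_arctan (√(‖η‖ ^ 2 - a ^ 2) / a)]
    exact le_tan (arctan_nonneg.2 (by positivity)) (arctan_lt_pi_div_two _)
  have h2 : √(‖η‖ ^ 2 - a ^ 2) / a ≤ τ * √(‖η‖ ^ 2 - a ^ 2) := by
    rw [div_le_iff₀ ha0]
    nlinarith [sqrt_nonneg (‖η‖ ^ 2 - a ^ 2)]
  linarith [Complex.abs_arg_le_pi η]

theorem isStable_iff_lt_abs_arg {τ a : ℝ} {η : ℂ} (hτ : 0 < τ) (ha : a * τ < 1) (hη : η ≠ 0)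
    (har : |a| ≤ ‖η‖) : IsStable τ a η ↔ levelArg τ a ‖η‖ 0 < |Complex.arg η| := by
  constructor
  · intro h
    by_contra! hle
    exact not_isStable_of_arg hτ hη ((neg_le_abs a).trans har) (Or.inr hle) h
  · intro h z hz
    by_contra! hre
    exact absurd (abs_arg_le_of_root hτ ha hη ((le_abs_self a).trans har) hz hre) h.not_ge

/-- Already `|Arg η| > arccos (-a/|η|)`; take cosines. -/
theorem re_add_neg_of_levelArg_lt {τ a : ℝ} {η : ℂ} (hτ : 0 < τ) (hη : η ≠ 0)
    (har : |a| ≤ ‖η‖) (h : levelArg τ a ‖η‖ 0 < |Complex.arg η|) : η.re + a < 0 := by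
  have hr : 0 < ‖η‖ := norm_pos_iff.2 hη
  have har' := abs_le.1 har
  rw [levelArg_zero hr] at h
  have h1 : arccos (-a / ‖η‖) < |Complex.arg η| :=
    lt_of_le_of_lt (le_add_of_nonneg_right (by positivity)) h
  have h2 := cos_lt_cos_of_nonneg_of_le_pi (arccos_nonneg _) (Complex.abs_arg_le_pi η) h1
  rw [cos_abs, cos_arccos (by rw [le_div_iff₀ hr]; linarith) (by rw [div_le_one hr]; linarith),
    lt_div_iff₀ hr, mul_comm, Complex.norm_mul_cos_arg] at h2
  linarith

/-- The modulus bounding `Λ_{τ,a}` lies beyond every modulus where the critical angle is below it. -/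
theorem exists_modulus {τ a v : ℝ} {η : ℂ}
    (h : τ * √(‖η‖ ^ 2 - a ^ 2) + arctan (-(1 / a) * √(‖η‖ ^ 2 - a ^ 2)) < v)
    (hv : ∃ w, v ≤ τ * w + arctan (-(1 / a) * w) ∧ √(‖η‖ ^ 2 - a ^ 2) ≤ w) :
    ∃ ηπ : ℂ, √(‖ηπ‖ ^ 2 - a ^ 2) * τ + arctan (-(1 / a) * √(‖ηπ‖ ^ 2 - a ^ 2)) = v ∧
      ‖η‖ < ‖ηπ‖ := by
  obtain ⟨w, hw, hle⟩ := hv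
  -- The unknown is `u = √(|η_π|² - a²)`.
  obtain ⟨u, hu, huv⟩ := intermediate_value_Icc
    (f := fun w => τ * w + arctan (-(1 / a) * w)) hle
    (by fun_prop) ⟨h.le, hw⟩
  have hlt : √(‖η‖ ^ 2 - a ^ 2) < u := by
    refine lt_of_le_of_ne hu.1 ?_
    rintro rfl
    exact h.ne huv
  have hu0 : 0 < u := (sqrt_nonneg _).trans_lt hlt
  have hnorm : ‖((√(u ^ 2 + a ^ 2) : ℝ) : ℂ)‖ = √(u ^ 2 + a ^ 2) := by
    rw [Complex.norm_real, norm_of_nonneg (sqrt_nonneg _)]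
  refine ⟨((√(u ^ 2 + a ^ 2) : ℝ) : ℂ), ?_, ?_⟩
  · rw [hnorm, sq_sqrt (by positivity), add_sub_cancel_right, sqrt_sq hu0.le, mul_comm u]
    exact huv
  · rw [hnorm]
    apply lt_sqrt_of_sq_lt
    have := (sqrt_lt' hu0).1 hlt
    linarith

theorem isStable_ofReal_iff_of_neg {τ a : ℝ} {η : ℂ} (hτ : 0 < τ) (ha : a < 0) :
    IsStable τ a η ↔ η ∈ LambdaNeg τ a := by
  rcases lt_or_ge ‖η‖ |a| with h | h
  · exact iff_of_true (isStable_of_norm_lt hτ ha h) (Or.inr (by simpa using h))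
  have hη : η ≠ 0 := norm_pos_iff.1 ((abs_pos.2 ha.ne).trans_le h)
  have hr : 0 < ‖η‖ := norm_pos_iff.2 hη
  have hball : η ∉ Metric.ball (0 : ℂ) |a| := by simpa using h
  rw [isStable_iff_lt_abs_arg hτ (by nlinarith) hη h]
  constructor
  · intro hlt
    refine Or.inl ⟨hball, re_add_neg_of_levelArg_lt hτ hη h hlt, ?_, ?_⟩
    · rw [levelArg_zero_of_neg ha hr] at hlt
      have hinv : 0 < -(1 / a) := by simpa using ha
      have hltπ := hlt.trans_le (Complex.abs_arg_le_pi η)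
      have hω := sqrt_nonneg (‖η‖ ^ 2 - a ^ 2)
      -- At `π / τ` the linear term alone reaches `π`.
      refine exists_modulus hltπ ⟨π / τ, ?_, ?_⟩
      · have : 0 ≤ arctan (-(1 / a) * (π / τ)) := arctan_nonneg.2 (by positivity)
        rw [mul_div_cancel₀ _ hτ.ne']
        linarith
      · have : 0 ≤ arctan (-(1 / a) * √(‖η‖ ^ 2 - a ^ 2)) := arctan_nonneg.2 (by positivity)
        rw [le_div_iff₀ hτ]
        linarith
    · rwa [← levelArg_zero_of_neg ha hr]
  · rintro (⟨-, -, -, hlt⟩ | hb)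
    · rwa [levelArg_zero_of_neg ha hr]
    · exact absurd hb hball

theorem isStable_ofReal_iff_of_pos {τ a : ℝ} {η : ℂ} (hτ : 0 < τ) (ha : 0 < a)
    (haτ : a * τ < 1) : IsStable τ a η ↔ η ∈ LambdaPos τ a := by
  rcases eq_or_ne η 0 with rfl | hη
  · refine iff_of_false (not_isStable_zero ha.le) fun h => ?_
    have := h.1
    simp at this
    linarith
  have hr : 0 < ‖η‖ := norm_pos_iff.2 hη
  rcases le_or_gt ‖η‖ a with h | h
  · refine iff_of_false (not_isStable_of_arg hτ hη (by linarith) (Or.inl h)) fun hm => ?_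
    have := hm.1
    linarith [(abs_le.1 (Complex.abs_re_le_norm η)).1]
  have har : |a| ≤ ‖η‖ := by rw [abs_of_pos ha]; exact h.le
  rw [isStable_iff_lt_abs_arg hτ haτ hη har]
  constructor
  · intro hlt
    refine ⟨re_add_neg_of_levelArg_lt hτ hη har hlt, ?_, ?_⟩
    · rw [levelArg_zero_of_pos ha hr] at hlt
      have hlt0 : τ * √(‖η‖ ^ 2 - a ^ 2) + arctan (-(1 / a) * √(‖η‖ ^ 2 - a ^ 2)) < 0 := by
        linarith [Complex.abs_arg_le_pi η]
      have hbound (w : ℝ) : -(π / 2) < arctan (-(1 / a) * w) := neg_pi_div_two_lt_arctan _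
      obtain ⟨ηπ, h1, h2⟩ := exists_modulus hlt0 ⟨π / τ, by
        rw [mul_div_cancel₀ _ hτ.ne']
        linarith [hbound (π / τ), pi_pos], by
        rw [le_div_iff₀ hτ]
        linarith [hbound √(‖η‖ ^ 2 - a ^ 2), pi_pos]⟩
      exact ⟨ηπ, h.trans h2, h1, h2⟩
    · rwa [← levelArg_zero_of_pos ha hr]
  · rintro ⟨-, -, hlt⟩
    rwa [levelArg_zero_of_pos ha hr]

theorem isStable_ofReal_zero_iff {τ : ℝ} {η : ℂ} (hτ : 0 < τ) :
    IsStable τ (0 : ℝ) η ↔ η ∈ LambdaZero τ := by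
  rcases eq_or_ne η 0 with rfl | hη
  · exact iff_of_false (not_isStable_zero le_rfl) fun h => h.1 rfl
  have hr : 0 < ‖η‖ := norm_pos_iff.2 hη
  have hl : levelArg τ 0 ‖η‖ 0 = τ * ‖η‖ + π / 2 := by
    rw [levelArg_zero hr]
    simp
    ring
  have har : |(0 : ℝ)| ≤ ‖η‖ := by simp
  rw [isStable_iff_lt_abs_arg hτ (by simp) hη har]
  constructor
  · intro hlt
    have hre := re_add_neg_of_levelArg_lt hτ hη har hlt
    rw [hl] at hlt
    refine ⟨hη, by simpa using hre, ?_, hlt⟩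
    rw [lt_div_iff₀ (by positivity)]
    linarith [Complex.abs_arg_le_pi η]
  · rintro ⟨-, -, -, hlt⟩
    rwa [hl]

theorem isStable_ofReal_iff {τ a : ℝ} {η : ℂ} (hτ : 0 < τ) :
    IsStable τ a η ↔ a < 1 / τ ∧ η ∈ Lambda τ a := by
  rw [lt_div_iff₀ hτ]
  rcases le_or_gt 1 (a * τ) with h | h
  · exact iff_of_false (not_isStable_of_one_le hτ h) fun h' => h'.1.not_ge h
  simp only [h, true_and, Lambda]
  split_ifs with h1 h2
  · exact isStable_ofReal_iff_of_neg hτ h1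
  · subst h2
    exact isStable_ofReal_zero_iff hτ
  · exact isStable_ofReal_iff_of_pos hτ (lt_of_le_of_ne (not_lt.1 h1) (Ne.symm h2)) h

/-! ### Reduction to real `λ` -/

/-- Shifting the roots by the imaginary part of `lam` makes `lam` real. -/
theorem charFun_add_im {τ : ℝ} {lam gam z : ℂ} :
    charFun τ lam gam (z + Complex.I * lam.im) =
      charFun τ lam.re (gam * Complex.exp (-(Complex.I * (lam.im : ℂ) * (τ : ℂ)))) z := by
  rw [charFun, charFun, mul_assoc, ← Complex.exp_add]
  have h : -((z + Complex.I * lam.im) * (τ : ℂ))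
      = -(Complex.I * (lam.im : ℂ) * (τ : ℂ)) + -(z * τ) := by ring
  rw [h]
  linear_combination Complex.re_add_im lam

theorem isStable_iff_ofReal {τ : ℝ} {lam gam : ℂ} :
    IsStable τ lam gam ↔
      IsStable τ lam.re (gam * Complex.exp (-(Complex.I * (lam.im : ℂ) * (τ : ℂ)))) := by
  constructor
  · intro h z hz
    simpa using h (z + Complex.I * lam.im) (by rwa [charFun_add_im])
  · intro h s hs
    have := h (s - Complex.I * lam.im) (by rwa [← charFun_add_im, sub_add_cancel])
    simpa using this

end DelayStability

theorem mainTheorem3 (τ : ℝ) (hτ : 0 < τ) (lam gam : ℕ → ℂ) :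
    (∀ k : ℕ, DelayStability.IsStable τ (lam k) (gam k)) ↔
      ∀ k : ℕ, (lam k).re < 1 / τ ∧
        gam k * Complex.exp (-(Complex.I * ((lam k).im : ℂ) * (τ : ℂ))) ∈
          DelayStability.Lambda τ (lam k).re :=
  forall_congr' fun _ =>
    DelayStability.isStable_iff_ofReal.trans (DelayStability.isStable_ofReal_iff hτ)
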